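/- Let $\mathcal H$ be a complex Hilbert space, let $\mathbb B(\mathcal H)^+$ be the cone of positive operators and $\mathbb P$ the set of positive invertible operators in $\mathbb B(\mathcal H)$, with the operator order. A *(two-variable) operator mean* is a map $\sigma:\mathbb B(\mathcal H)^+\times\mathbb B(\mathcal H)^+\to\mathbb B(\mathcal H)^+$ such that (i) $A\le C$, $B\le D$ imply $A\,\sigma\,B\le C\,\sigma\,D$; (ii) $C(A\,\sigma\,B)C\le (CAC)\,\sigma\,(CBC)$ for $C\in\mathbb B(\mathcal H)^+$; (iii) $A_k\searrow A$, $B_k\searrow B$ imply $A_k\,\sigma\,B_k\searrow A\,\sigma\,B$ (decreasing sequences, convergence in the strong operator topology); (iv) $I\,\sigma\,I=I$. An *$n$-variable operator mean* is a map $\mathfrak M:\mathbb P^n\to\mathbb P$ that is (I) monotone in the operator order; (II) congruence invariant, $S^*\mathfrak M(A_1,\dots,A_n)S=\mathfrak M(S^*A_1S,\dots,S^*A_nS)$ for all invertible $S\in\mathbb B(\mathcal H)$; (III) monotonically continuous: if $A_{jk}\nearrow A_j$ for all $j$, or $A_{jk}\searrow A_j$ for all $j$, as $k\to\infty$ (all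 operators in $\mathbb P$), then $\mathfrak M(A_{1k},\dots,A_{nk})\to\mathfrak M(A_1,\dots,A_n)$ strongly; (IV) normalized, $\mathfrak M(I,\dots,I)=I$. For an $n$-variable operator mean $\mathfrak M$ and an operator mean $\sigma$ that is not the left trivial mean $A\,\ell\,B=A$, the *deformed mean* $\mathfrak M_\sigma(A_1,\dots,A_n)$ of $A_1,\dots,A_n\in\mathbb P$ is the solution $X\in\mathbb P$ of $X=\mathfrak M(X\,\sigma\,A_1,\dots,X\,\sigma\,A_n)$. (It exists, and is unique except possibly when $\dim\mathcal H=1$, in which case a solution is fixed.) For a probability vector $\omega=(\omega_1,\dots,\omega_n)$ put $\mathcal A_\omega(A_1,\dots,A_n)=\sum_j\omega_jA_j$ and $\mathcal H_\omega(A_1,\dots,A_n)=\bigl(\sum_j\omega_jA_j^{-1}\bigr)^{-1}$. For $h>1$ and $p\in\mathbb R\setminus\{0,1\}$ the generalized Kantorovich constant is $$K(h,p)=\frac{h^p-h}{(p-1)(h-1)}\left(\frac{p-1}{p}\,\frac{h^p-1}{h^p-h}\right)^p,$$ and $K(h,0)=K(h,1)=1$, by continuity. **Corollary 3.7.** Let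 $\mathfrak M$ be an $n$-variable operator mean and $\sigma\neq\ell$ an operator mean such that, for some probability vector $\omega$, $\mathcal H_\omega(B_1,\dots,B_n)\le\mathfrak M_\sigma(B_1,\dots,B_n)\le\mathcal A_\omega(B_1,\dots,B_n)$ for all $B_1,\dots,B_n\in\mathbb P$. Let $A_1,\dots,A_n\in\mathbb P$ with $mI\le A_j\le MI$ for all $j$, where $0<m<M$ are scalars, and let $h=M/m$. Then $$K(h,-r)^{-1}\,\mathfrak M_\sigma(A_1,\dots,A_n)^r\le\mathfrak M_\sigma(A_1^r,\dots,A_n^r)\le K(h,-r)\,\mathfrak M_\sigma(A_1,\dots,A_n)^r\qquad(0<r<1)$$ and $$K(h,-r)^{-1}K(h,r)^{-1}\,\mathfrak M_\sigma(A_1,\dots,A_n)^r\le\mathfrak M_\sigma(A_1^r,\dots,A_n^r)\le K(h,-r)K(h,r)\,\mathfrak M_\sigma(A_1,\dots,A_n)^r\qquad(r\ge1).$$ In particular, if $\mathfrak M_\sigma(A_1,\dots,A_n)\le I$, then $\mathfrak M_\sigma(A_1^r,\dots,A_n^r)\le K(h,-r)I$ for $0<r<1$, and $\mathfrak M_\sigma(A_1^r,\dots,A_n^r)\le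 K(h,-r)K(h,r)I$ for $r\ge1$. -/

import Mathlib

open Filter Topology

noncomputable section

/-- The cone `𝔹(H)⁺` of positive operators, with the operator (Loewner) order. -/
abbrev PosOp (H : Type*) [NormedAddCommGroup H] [InnerProductSpace ℂ H] [CompleteSpace H] :=
  {T : H →L[ℂ] H // 0 ≤ T}

/-- The set `ℙ(H)` of positive invertible operators, with the operator order
(`IsStrictlyPositive T` means `0 ≤ T ∧ IsUnit T`). -/
abbrev PosInvOp (H : Type*) [NormedAddCommGroup H] [InnerProductSpace ℂ H] [CompleteSpace H] :=
  {T : H →L[ℂ] H // IsStrictlyPositive T}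

section Basic

variable {H : Type*} [NormedAddCommGroup H] [InnerProductSpace ℂ H] [CompleteSpace H]

/-- `T k ↘ S`: the sequence decreases and converges to `S` in the strong operator topology. -/
def DecreasesTo (T : ℕ → H →L[ℂ] H) (S : H →L[ℂ] H) : Prop :=
  Antitone T ∧ ∀ x : H, Tendsto (fun k => T k x) atTop (𝓝 (S x))

/-- `T k ↗ S`: the sequence increases and converges to `S` in the strong operator topology. -/
def IncreasesTo (T : ℕ → H →L[ℂ] H) (S : H →L[ℂ] H) : Prop :=
  Monotone T ∧ ∀ x : H, Tendsto (fun k => T k x) atTop (𝓝 (S x))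

namespace PosOp

/-- The identity operator. -/
def one : PosOp H := ⟨1, zero_le_one⟩

/-- The operator `C A C`, for positive `C` and `A`. -/
def conj (C A : PosOp H) : PosOp H :=
  ⟨C.1 * A.1 * C.1, conjugate_nonneg_of_nonneg A.2 C.2⟩

end PosOp

namespace PosInvOp

/-- The identity operator. -/
def one : PosInvOp H := ⟨1, isStrictlyPositive_one⟩

/-- A positive invertible operator, seen as a positive operator. -/
def toPosOp (A : PosInvOp H) : PosOp H := ⟨A.1, A.2.nonneg⟩

/-- The operator `S* A S`, for invertible `S` and `A ∈ ℙ(H)`. -/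
def conj (S : (H →L[ℂ] H)ˣ) (A : PosInvOp H) : PosInvOp H :=
  ⟨star (S : H →L[ℂ] H) * A.1 * (S : H →L[ℂ] H),
    S.isUnit.isStrictlyPositive_star_left_conjugate_iff.mpr A.2⟩

/-- The real power `A ^ r` (continuous functional calculus). -/
def rpow (A : PosInvOp H) (r : ℝ) : PosInvOp H := ⟨A.1 ^ r, A.2.rpow A.1 r⟩

end PosInvOp

end Basic

/-- Two-variable operator means in the sense of Kubo and Ando. -/
structure OperatorMean (H : Type*) [NormedAddCommGroup H] [InnerProductSpace ℂ H]
    [CompleteSpace H] where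
  toFun : PosOp H → PosOp H → PosOp H
  monotone : ∀ A B C D : PosOp H, A ≤ C → B ≤ D → toFun A B ≤ toFun C D
  transformer : ∀ A B C : PosOp H,
    PosOp.conj C (toFun A B) ≤ toFun (PosOp.conj C A) (PosOp.conj C B)
  downward : ∀ (A B : ℕ → PosOp H) (A' B' : PosOp H),
    DecreasesTo (fun k => (A k).1) A'.1 → DecreasesTo (fun k => (B k).1) B'.1 →
      DecreasesTo (fun k => (toFun (A k) (B k)).1) (toFun A' B').1
  normalized : toFun PosOp.one PosOp.one = PosOp.one

/-- `n`-variable operator means on `ℙ(H)`: monotone, invariant under congruences, continuous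
along monotone sequences, and normalized. -/
structure MultiOperatorMean (H : Type*) [NormedAddCommGroup H] [InnerProductSpace ℂ H]
    [CompleteSpace H] (n : ℕ) where
  toFun : (Fin n → PosInvOp H) → PosInvOp H
  monotone : ∀ A B : Fin n → PosInvOp H, (∀ j, A j ≤ B j) → toFun A ≤ toFun B
  congruence : ∀ (S : (H →L[ℂ] H)ˣ) (A : Fin n → PosInvOp H),
    PosInvOp.conj S (toFun A) = toFun (fun j => PosInvOp.conj S (A j))
  continuity : ∀ (A : ℕ → Fin n → PosInvOp H) (A' : Fin n → PosInvOp H),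
    ((∀ j, IncreasesTo (fun k => (A k j).1) (A' j).1) ∨
      (∀ j, DecreasesTo (fun k => (A k j).1) (A' j).1)) →
      ∀ x : H, Tendsto (fun k => (toFun (A k)).1 x) atTop (𝓝 ((toFun A').1 x))
  normalized : toFun (fun _ => PosInvOp.one) = PosInvOp.one

section Scalars

variable {H : Type*} [NormedAddCommGroup H] [InnerProductSpace ℂ H] [CompleteSpace H]

/-- The scalar operator `c I`, `c > 0`. -/
def PosInvOp.scalar (H : Type*) [NormedAddCommGroup H] [InnerProductSpace ℂ H] [CompleteSpace H]
    (c : ℝ) (hc : 0 < c) : PosInvOp H :=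
  ⟨algebraMap ℝ (H →L[ℂ] H) c, isStrictlyPositive_algebraMap hc⟩

theorem PosInvOp.exists_scalar_le (A : PosInvOp H) :
    ∃ c : ℝ, ∃ hc : 0 < c, PosInvOp.scalar H c hc ≤ A := by
  rcases subsingleton_or_nontrivial H with h | h
  · refine ⟨1, one_pos, ?_⟩
    change (PosInvOp.scalar H 1 one_pos).1 ≤ A.1
    exact le_of_eq (Subsingleton.elim _ _)
  · obtain ⟨r, hr, h⟩ := (CFC.exists_pos_algebraMap_le_iff A.2.isSelfAdjoint).mpr
      (fun x hx => A.2.spectrum_pos hx)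
    exact ⟨r, hr, h⟩

theorem PosInvOp.le_scalar (A : PosInvOp H) (c : ℝ) (hc : 0 < c) (h : ‖A.1‖ ≤ c) :
    A ≤ PosInvOp.scalar H c hc :=
  (CStarAlgebra.norm_le_iff_le_algebraMap A.1 hc.le A.2.nonneg).mp h

theorem PosInvOp.scalar_mono {c d : ℝ} (hc : 0 < c) (hd : 0 < d) (h : c ≤ d) :
    PosInvOp.scalar H c hc ≤ PosInvOp.scalar H d hd :=
  algebraMap_mono (H →L[ℂ] H) h

theorem OperatorMean.scalar_le (σ : OperatorMean H) (c : ℝ) (hc : 0 < c) :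
    (PosInvOp.scalar H c hc).toPosOp ≤
      σ.toFun (PosInvOp.scalar H c hc).toPosOp (PosInvOp.scalar H c hc).toPosOp := by
  have h := σ.transformer PosOp.one PosOp.one
    (PosInvOp.scalar H (Real.sqrt c) (Real.sqrt_pos.mpr hc)).toPosOp
  rw [σ.normalized] at h
  have e : PosOp.conj (PosInvOp.scalar H (Real.sqrt c) (Real.sqrt_pos.mpr hc)).toPosOp PosOp.one
      = (PosInvOp.scalar H c hc).toPosOp := by
    apply Subtype.ext
    simp only [PosOp.conj, PosInvOp.toPosOp, PosInvOp.scalar, PosOp.one, mul_one]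
    rw [← map_mul, Real.mul_self_sqrt hc.le]
  rwa [e] at h

theorem OperatorMean.le_scalar (σ : OperatorMean H) (c : ℝ) (hc : 0 < c) :
    σ.toFun (PosInvOp.scalar H c hc).toPosOp (PosInvOp.scalar H c hc).toPosOp ≤
      (PosInvOp.scalar H c hc).toPosOp := by
  have hs : 0 < Real.sqrt c := Real.sqrt_pos.mpr hc
  have h := σ.transformer (PosInvOp.scalar H c hc).toPosOp (PosInvOp.scalar H c hc).toPosOp
    (PosInvOp.scalar H (Real.sqrt c)⁻¹ (inv_pos.mpr hs)).toPosOp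
  have e : PosOp.conj (PosInvOp.scalar H (Real.sqrt c)⁻¹ (inv_pos.mpr hs)).toPosOp
      (PosInvOp.scalar H c hc).toPosOp = PosOp.one := by
    apply Subtype.ext
    simp only [PosOp.conj, PosInvOp.toPosOp, PosInvOp.scalar, PosOp.one]
    rw [← map_mul, ← map_mul]
    have : (Real.sqrt c)⁻¹ * c * (Real.sqrt c)⁻¹ = 1 := by
      field_simp
      exact (Real.sq_sqrt hc.le).symm
    rw [this, map_one]
  rw [e, σ.normalized] at h
  set T := (σ.toFun (PosInvOp.scalar H c hc).toPosOp (PosInvOp.scalar H c hc).toPosOp).1 with hT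
  have h' : algebraMap ℝ (H →L[ℂ] H) (Real.sqrt c)⁻¹ * T *
      algebraMap ℝ (H →L[ℂ] H) (Real.sqrt c)⁻¹ ≤ 1 := h
  have h2 := conjugate_le_conjugate_of_nonneg h'
    (PosInvOp.scalar H (Real.sqrt c) hs).2.nonneg
  change T ≤ algebraMap ℝ (H →L[ℂ] H) c
  have a1 : algebraMap ℝ (H →L[ℂ] H) (Real.sqrt c) * algebraMap ℝ (H →L[ℂ] H) (Real.sqrt c)⁻¹
      = 1 := by rw [← map_mul, mul_inv_cancel₀ hs.ne', map_one]
  have a2 : algebraMap ℝ (H →L[ℂ] H) (Real.sqrt c)⁻¹ * algebraMap ℝ (H →L[ℂ] H) (Real.sqrt c)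
      = 1 := by rw [← map_mul, inv_mul_cancel₀ hs.ne', map_one]
  have e1 : algebraMap ℝ (H →L[ℂ] H) (Real.sqrt c) *
      (algebraMap ℝ (H →L[ℂ] H) (Real.sqrt c)⁻¹ * T *
        algebraMap ℝ (H →L[ℂ] H) (Real.sqrt c)⁻¹) *
        algebraMap ℝ (H →L[ℂ] H) (Real.sqrt c) = T := by
    rw [← mul_assoc, ← mul_assoc, a1, one_mul, mul_assoc, a2, mul_one]
  have e2 : algebraMap ℝ (H →L[ℂ] H) (Real.sqrt c) * 1 *
        algebraMap ℝ (H →L[ℂ] H) (Real.sqrt c) = algebraMap ℝ (H →L[ℂ] H) c := by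
    rw [mul_one, ← map_mul, Real.mul_self_sqrt hc.le]
  change algebraMap ℝ (H →L[ℂ] H) (Real.sqrt c) *
      (algebraMap ℝ (H →L[ℂ] H) (Real.sqrt c)⁻¹ * T *
        algebraMap ℝ (H →L[ℂ] H) (Real.sqrt c)⁻¹) *
        algebraMap ℝ (H →L[ℂ] H) (Real.sqrt c) ≤
      algebraMap ℝ (H →L[ℂ] H) (Real.sqrt c) * 1 *
        algebraMap ℝ (H →L[ℂ] H) (Real.sqrt c) at h2
  rwa [e1, e2] at h2

theorem MultiOperatorMean.scalar_eq {n : ℕ} (𝔐 : MultiOperatorMean H n) (c : ℝ) (hc : 0 < c) :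
    𝔐.toFun (fun _ => PosInvOp.scalar H c hc) = PosInvOp.scalar H c hc := by
  have hu := (PosInvOp.scalar H (Real.sqrt c) (Real.sqrt_pos.mpr hc)).2.isUnit
  have e : PosInvOp.conj hu.unit PosInvOp.one = PosInvOp.scalar H c hc := by
    apply Subtype.ext
    have hsa := (PosInvOp.scalar H (Real.sqrt c) (Real.sqrt_pos.mpr hc)).2.isSelfAdjoint.star_eq
    simp only [PosInvOp.conj, PosInvOp.one, mul_one, IsUnit.unit_spec]
    rw [hsa]
    simp only [PosInvOp.scalar]
    rw [← map_mul, Real.mul_self_sqrt hc.le]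
  have h := 𝔐.congruence hu.unit (fun _ => PosInvOp.one)
  rw [𝔐.normalized, e] at h
  exact h.symm

/-- An operator mean of positive invertible operators is invertible. -/
theorem OperatorMean.isStrictlyPositive (σ : OperatorMean H) (A B : PosInvOp H) :
    IsStrictlyPositive (σ.toFun A.toPosOp B.toPosOp).1 := by
  obtain ⟨a, ha, hA⟩ := A.exists_scalar_le
  obtain ⟨b, hb, hB⟩ := B.exists_scalar_le
  have hc : 0 < min a b := lt_min ha hb
  refine (PosInvOp.scalar H (min a b) hc).2.of_le (le_trans (σ.scalar_le (min a b) hc) ?_)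
  exact σ.monotone _ _ _ _ ((PosInvOp.scalar_mono hc ha (min_le_left a b)).trans hA)
    ((PosInvOp.scalar_mono hc hb (min_le_right a b)).trans hB)

/-- The operator mean `A σ B` of `A, B ∈ ℙ(H)`, as an element of `ℙ(H)`. -/
def OperatorMean.mean (σ : OperatorMean H) (A B : PosInvOp H) : PosInvOp H :=
  ⟨(σ.toFun A.toPosOp B.toPosOp).1, σ.isStrictlyPositive A B⟩

theorem OperatorMean.mean_mono (σ : OperatorMean H) {A B C D : PosInvOp H} (h : A ≤ C)
    (h' : B ≤ D) : σ.mean A B ≤ σ.mean C D :=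
  σ.monotone A.toPosOp B.toPosOp C.toPosOp D.toPosOp h h'

/-- A decreasing sequence of positive operators converges in the strong operator topology. -/
theorem exists_decreasesTo (T : ℕ → H →L[ℂ] H) (hT : Antitone T) (h0 : ∀ k, 0 ≤ T k) :
    ∃ S : H →L[ℂ] H, DecreasesTo T S := by
  have key : ∀ x : H, CauchySeq (fun k => T k x) := by
    intro x
    have hq : Antitone (fun k => (T k).reApplyInnerSelf x) := by
      intro k l hkl
      have := ((ContinuousLinearMap.le_def _ _).mp (hT hkl)).re_inner_nonneg_left x
      simp only [sub_apply, inner_sub_left, map_sub] at this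
      simpa [ContinuousLinearMap.reApplyInnerSelf_apply] using this
    have hq0 : BddBelow (Set.range (fun k => (T k).reApplyInnerSelf x)) := by
      refine ⟨0, ?_⟩
      rintro _ ⟨k, rfl⟩
      exact ((ContinuousLinearMap.nonneg_iff_isPositive _).mp (h0 k)).re_inner_nonneg_left x
    have hqc : CauchySeq (fun k => (T k).reApplyInnerSelf x) :=
      (tendsto_atTop_ciInf hq hq0).cauchySeq
    have bound : ∀ k l, k ≤ l → ‖T k x - T l x‖ ^ 2 ≤
        ‖T 0‖ * ((T k).reApplyInnerSelf x - (T l).reApplyInnerSelf x) := by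
      intro k l hkl
      have hD : 0 ≤ T k - T l := sub_nonneg.mpr (hT hkl)
      have hDle : T k - T l ≤ T 0 :=
        (sub_le_self _ (h0 l)).trans (hT (Nat.zero_le k))
      have hDn : ‖T k - T l‖ ≤ ‖T 0‖ := CStarAlgebra.norm_le_norm_of_nonneg_of_le hD hDle
      set S := CFC.sqrt (T k - T l) with hS
      have hSS : S * S = T k - T l := CFC.sqrt_mul_sqrt_self _ hD
      have hSsa : IsSelfAdjoint S := (CFC.sqrt_nonneg (T k - T l)).isSelfAdjoint
      have hSn : ‖S‖ ^ 2 = ‖T k - T l‖ := by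
        rw [sq, ← CStarRing.norm_star_mul_self, hSsa.star_eq, hSS]
      have h1 : T k x - T l x = S (S x) := by
        have := congrArg (fun R : H →L[ℂ] H => R x) hSS
        simpa using this.symm
      have h2 : ‖S x‖ ^ 2 = (T k).reApplyInnerSelf x - (T l).reApplyInnerSelf x := by
        have e : (T k).reApplyInnerSelf x - (T l).reApplyInnerSelf x
            = RCLike.re (inner ℂ (S (S x)) x) := by
          rw [← h1]
          simp [ContinuousLinearMap.reApplyInnerSelf_apply]
        rw [e]
        have : inner ℂ (S (S x)) x = inner ℂ (S x) (S x) := by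
          conv_lhs => rw [← hSsa.star_eq, ContinuousLinearMap.star_eq_adjoint,
            ContinuousLinearMap.adjoint_inner_left]
          rw [← ContinuousLinearMap.star_eq_adjoint, hSsa.star_eq]
        rw [this, inner_self_eq_norm_sq]
      rw [h1, ← h2]
      calc ‖S (S x)‖ ^ 2 ≤ (‖S‖ * ‖S x‖) ^ 2 := by gcongr; exact S.le_opNorm _
        _ = ‖T k - T l‖ * ‖S x‖ ^ 2 := by rw [mul_pow, hSn]
        _ ≤ ‖T 0‖ * ‖S x‖ ^ 2 := by gcongr
    rw [Metric.cauchySeq_iff'] at hqc ⊢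
    intro ε hε
    obtain ⟨N, hN⟩ := hqc (ε ^ 2 / (‖T 0‖ + 1)) (by positivity)
    refine ⟨N, fun k hk => ?_⟩
    have b := bound N k hk
    have hN' := hN k hk
    rw [Real.dist_eq, abs_sub_comm] at hN'
    have h3 := (le_abs_self _).trans_lt hN'
    have h4 : 0 ≤ (T N).reApplyInnerSelf x - (T k).reApplyInnerSelf x := sub_nonneg.mpr (hq hk)
    rw [lt_div_iff₀ (by positivity)] at h3
    rw [dist_comm, dist_eq_norm]
    have h5 : ‖T N x - T k x‖ ^ 2 < ε ^ 2 := by nlinarith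
    exact lt_of_pow_lt_pow_left₀ 2 hε.le h5
  choose f hf using fun x => cauchySeq_tendsto_of_complete (key x)
  exact ⟨continuousLinearMapOfTendsto T (tendsto_pi_nhds.mpr hf), hT, hf⟩

theorem DecreasesTo.le_limit {T : ℕ → H →L[ℂ] H} {S R : H →L[ℂ] H} (h : DecreasesTo T S)
    (hR : ∀ k, R ≤ T k) : R ≤ S := by
  rw [ContinuousLinearMap.le_def, ContinuousLinearMap.isPositive_iff_complex]
  intro x
  have hp := fun k => (ContinuousLinearMap.isPositive_iff_complex _).mp
    ((ContinuousLinearMap.le_def _ _).mp (hR k)) x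
  have ht : Tendsto (fun k => inner ℂ ((T k - R) x) x) atTop (𝓝 (inner ℂ ((S - R) x) x)) := by
    refine Tendsto.inner ?_ tendsto_const_nhds
    simpa using (h.2 x).sub_const (R x)
  have hre := (Complex.continuous_re.tendsto _).comp ht
  constructor
  · refine tendsto_nhds_unique ?_ ht
    have := (Complex.continuous_ofReal.tendsto _).comp hre
    refine this.congr fun k => ?_
    exact (hp k).1
  · exact ge_of_tendsto' hre fun k => (hp k).2

/-- The equation defining the deformed mean has a solution: iterate
`X ↦ 𝔐 (X σ A₁, …, X σ Aₙ)` from a large multiple of the identity. -/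
theorem exists_deformedMean {n : ℕ} (𝔐 : MultiOperatorMean H n) (σ : OperatorMean H)
    (A : Fin n → PosInvOp H) :
    ∃ X : PosInvOp H, X = 𝔐.toFun (fun j => σ.mean X (A j)) := by
  choose a ha haA using fun j => (A j).exists_scalar_le
  obtain ⟨m, hm, hmA⟩ : ∃ m : ℝ, ∃ hm : 0 < m, ∀ j, PosInvOp.scalar H m hm ≤ A j := by
    obtain ⟨m, hm⟩ := (Set.finite_range fun j => (a j)⁻¹).bddAbove
    have h1 : 0 < max m 1 := lt_max_of_lt_right one_pos
    refine ⟨(max m 1)⁻¹, inv_pos.mpr h1, fun j => ?_⟩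
    refine (PosInvOp.scalar_mono _ (ha j) ?_).trans (haA j)
    exact inv_le_of_inv_le₀ (ha j) ((hm ⟨j, rfl⟩).trans (le_max_left _ _))
  obtain ⟨M, hM, hMm, hMA⟩ : ∃ M : ℝ, ∃ hM : 0 < M, m ≤ M ∧
      ∀ j, A j ≤ PosInvOp.scalar H M hM := by
    obtain ⟨M, hM⟩ := (Set.finite_range fun j => ‖(A j).1‖).bddAbove
    refine ⟨max M m, lt_max_of_lt_right hm, le_max_right _ _, fun j => ?_⟩
    exact (A j).le_scalar _ _ ((hM ⟨j, rfl⟩).trans (le_max_left _ _))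
  let F : PosInvOp H → PosInvOp H := fun X => 𝔐.toFun (fun j => σ.mean X (A j))
  have hF : Monotone F := fun X Y h => 𝔐.monotone _ _ fun j => σ.mean_mono h le_rfl
  have hFM : F (PosInvOp.scalar H M hM) ≤ PosInvOp.scalar H M hM := by
    refine (𝔐.monotone _ (fun _ => PosInvOp.scalar H M hM) fun j => ?_).trans
      (𝔐.scalar_eq M hM).le
    exact (σ.mean_mono le_rfl (hMA j)).trans (σ.le_scalar M hM)
  have hFm : PosInvOp.scalar H m hm ≤ F (PosInvOp.scalar H m hm) := by
    refine (𝔐.scalar_eq m hm).ge.trans (𝔐.monotone (fun _ => PosInvOp.scalar H m hm) _ fun j => ?_)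
    exact le_trans (b := σ.mean (PosInvOp.scalar H m hm) (PosInvOp.scalar H m hm))
      (σ.scalar_le m hm) (σ.mean_mono le_rfl (hmA j))
  let X : ℕ → PosInvOp H := fun k => F^[k] (PosInvOp.scalar H M hM)
  have hXs : ∀ k, X (k + 1) = F (X k) := fun k => Function.iterate_succ_apply' F k _
  have hXanti : Antitone X := hF.antitone_iterate_of_map_le hFM
  have hXm : ∀ k, PosInvOp.scalar H m hm ≤ X k := by
    intro k
    induction k with
    | zero => exact PosInvOp.scalar_mono hm hM hMm
    | succ k ih => rw [hXs]; exact hFm.trans (hF ih)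
  obtain ⟨S, hS⟩ := exists_decreasesTo (fun k => (X k).1) hXanti fun k => (X k).2.nonneg
  have hSpos : IsStrictlyPositive S :=
    (PosInvOp.scalar H m hm).2.of_le (hS.le_limit hXm)
  refine ⟨⟨S, hSpos⟩, ?_⟩
  have hmean : ∀ j, DecreasesTo (fun k => (σ.mean (X k) (A j)).1) (σ.mean ⟨S, hSpos⟩ (A j)).1 :=
    fun j => σ.downward (fun k => (X k).toPosOp) (fun _ => (A j).toPosOp)
      (PosInvOp.toPosOp ⟨S, hSpos⟩) (A j).toPosOp hS
      ⟨antitone_const, fun x => tendsto_const_nhds⟩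
  have hlim := 𝔐.continuity (fun k j => σ.mean (X k) (A j)) (fun j => σ.mean ⟨S, hSpos⟩ (A j))
    (Or.inr hmean)
  apply Subtype.ext
  ext x
  refine tendsto_nhds_unique ((tendsto_add_atTop_iff_nat 1).mpr (hS.2 x)) ?_
  simpa only [hXs] using hlim x

end Scalars

section Means

variable {H : Type*} [NormedAddCommGroup H] [InnerProductSpace ℂ H] [CompleteSpace H]

/-- The left trivial mean `A ℓ B = A`. -/
def OperatorMean.IsLeftTrivial (σ : OperatorMean H) : Prop :=
  ∀ A B : PosOp H, σ.toFun A B = A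

/-- The deformed mean `𝔐_σ (A₁, …, Aₙ)`: the solution `X ∈ ℙ(H)` of
`X = 𝔐 (X σ A₁, …, X σ Aₙ)`, for `σ ≠ ℓ`. A solution exists by `exists_deformedMean`. For `σ ≠ ℓ`
it is unique, except possibly when `dim H = 1`, where a solution is chosen. -/
def deformedMean {n : ℕ} (𝔐 : MultiOperatorMean H n) (σ : OperatorMean H)
    (A : Fin n → PosInvOp H) : PosInvOp H :=
  Classical.choose (exists_deformedMean 𝔐 σ A)

theorem deformedMean_spec {n : ℕ} (𝔐 : MultiOperatorMean H n) (σ : OperatorMean H)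
    (A : Fin n → PosInvOp H) :
    deformedMean 𝔐 σ A = 𝔐.toFun (fun j => σ.mean (deformedMean 𝔐 σ A) (A j)) :=
  Classical.choose_spec (exists_deformedMean 𝔐 σ A)

/-- The weighted arithmetic mean `∑ ω_j A_j`. -/
def arithmeticMean {n : ℕ} (ω : Fin n → ℝ) (A : Fin n → PosInvOp H) : H →L[ℂ] H :=
  ∑ j, ω j • (A j).1

/-- The weighted harmonic mean `(∑ ω_j A_j⁻¹)⁻¹`; all the inverses are those of invertible
operators as soon as `ω` is a probability vector. -/
def harmonicMean {n : ℕ} (ω : Fin n → ℝ) (A : Fin n → PosInvOp H) : H →L[ℂ] H :=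
  Ring.inverse (∑ j, ω j • Ring.inverse (A j).1)

end Means

/-- The generalized Kantorovich constant `K(h, p)`, for `h > 0`, with the removable
singularities at `p = 0`, `p = 1` and `h = 1` filled in by the limit value `1`. -/
def kantorovichConst (h p : ℝ) : ℝ :=
  if p = 0 ∨ p = 1 ∨ h = 1 then 1
  else (h ^ p - h) / ((p - 1) * (h - 1)) *
    ((p - 1) / p * ((h ^ p - 1) / (h ^ p - h))) ^ p

end

/-! Write `D` for the deformed mean of the `A j` and `h = M / m`. By hypothesis every deformed mean
lies between the weighted harmonic and arithmetic means, so it suffices to bound the arithmetic mean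
of the powers `A j ^ r` above by the `r`-th power of the harmonic mean, and their harmonic mean
below by the `r`-th power of the arithmetic mean. Both bounds are one converse Jensen inequality for
the exponent `-r` (`CFC.sum_smul_rpow_le`), and each costs a factor `K(h, -r)`.

The powers of these means are then compared with `D ^ r`. For `r < 1` this is the Löwner–Heinz
inequality. For `r ≥ 1`, where `t ↦ t ^ r` need not be operator monotone, `CFC.rpow_le_smul_rpow`
does it at the cost of `K(h, r)`.

Both operator inequalities use the Mond–Pečarić method: an affine function, the chord of `t ^ p`
over `[m, M]`, is inserted between `t ^ p` and `K(h, p) t ^ p` (`exists_chord_rpow`). Affine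
functions commute with weighted averages and, if increasing, preserve the operator order. -/

/-! ### Scalar inequalities: tangents, chords and the Kantorovich constant. -/

theorem one_add_mul_sub_le_rpow {p : ℝ} (hp : p < 0 ∨ 1 < p) {x : ℝ} (hx : 0 < x) :
    1 + p * (x - 1) ≤ x ^ p := by
  rcases hp with hp | hp
  -- For `p < 0`: `x ^ p = exp (p log x) ≥ 1 + p log x`, and multiplying `log x ≤ x - 1` by `p`
  -- reverses it.
  · have h1 := Real.add_one_le_exp (Real.log x * p)
    rw [← Real.rpow_def_of_pos hx] at h1
    nlinarith [Real.log_le_sub_one_of_pos hx]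
  · simpa using one_add_mul_self_le_rpow_one_add (s := x - 1) (by linarith) hp.le

/-- The graph of `t ↦ t ^ p` lies above its tangents on the positive half line. -/
theorem rpow_tangent_le {p : ℝ} (hp : p < 0 ∨ 1 < p) {x y : ℝ} (hx : 0 < x) (hy : 0 < y) :
    x ^ p + p * (x ^ p / x) * (y - x) ≤ y ^ p := by
  have h := one_add_mul_sub_le_rpow hp (div_pos hy hx)
  have hxp := Real.rpow_pos_of_pos hx p
  rw [Real.div_rpow hy.le hx.le, le_div_iff₀ hxp] at h
  calc x ^ p + p * (x ^ p / x) * (y - x) = (1 + p * (y / x - 1)) * x ^ p := by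
        field_simp
    _ ≤ y ^ p := h

/-- Take the tangent at `s`, evaluate it at the endpoints `1` and `h`, and add with weights `h - s`
and `s - 1`: the slope terms cancel. -/
theorem rpow_le_chord {p : ℝ} (hp : p < 0 ∨ 1 < p) {h s : ℝ} (hh : 1 < h) (h1 : 1 ≤ s)
    (h2 : s ≤ h) : s ^ p ≤ (h ^ p - 1) / (h - 1) * s + (h - h ^ p) / (h - 1) := by
  have hs : 0 < s := by linarith
  have e1 := rpow_tangent_le hp hs one_pos
  have e2 := rpow_tangent_le hp hs (by linarith : 0 < h)
  rw [Real.one_rpow] at e1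
  have key : s ^ p * (h - 1) ≤ (h ^ p - 1) * s + (h - h ^ p) := by
    have f1 := mul_le_mul_of_nonneg_left e1 (sub_nonneg.mpr h2)
    have f2 := mul_le_mul_of_nonneg_left e2 (sub_nonneg.mpr h1)
    linarith
  rw [div_mul_eq_mul_div, ← add_div, le_div_iff₀ (by linarith)]
  exact key

/-- The signs that let `p < 0` and `p > 1` be treated together; the quotient of these two numbers is
the point of tangency used below. -/
theorem kantorovich_aux_pos {p h : ℝ} (hp : p < 0 ∨ 1 < p) (hh : 1 < h) :
    0 < (h ^ p - h) / (p - 1) ∧ 0 < (h ^ p - 1) / p := by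
  rcases hp with hp | hp
  · have h1 : h ^ p < 1 := Real.rpow_lt_one_of_one_lt_of_neg hh hp
    exact ⟨div_pos_of_neg_of_neg (by linarith) (by linarith),
      div_pos_of_neg_of_neg (by linarith) hp⟩
  · have h1 : h < h ^ p := by simpa using Real.rpow_lt_rpow_of_exponent_lt hh hp
    exact ⟨div_pos (by linarith) (by linarith), div_pos (by linarith) (by linarith)⟩

theorem kantorovichConst_pos {p h : ℝ} (hp : p < 0 ∨ 1 < p) (hh : 1 < h) :
    0 < kantorovichConst h p := by
  obtain ⟨h1, h2⟩ := kantorovich_aux_pos hp hh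
  have h3 : ¬ (p = 0 ∨ p = 1 ∨ h = 1) := by
    rintro (rfl | rfl | rfl) <;> simp_all
  rw [kantorovichConst, if_neg h3]
  refine mul_pos ?_ (Real.rpow_pos_of_pos ?_ _)
  · rw [← div_div]; exact div_pos h1 (by linarith)
  · have : (p - 1) / p * ((h ^ p - 1) / (h ^ p - h))
        = (h ^ p - 1) / p / ((h ^ p - h) / (p - 1)) := by
      rw [div_div_div_eq, div_mul_div_comm, mul_comm (p - 1)]
    rw [this]
    exact div_pos h2 h1

/-- The constant is chosen so that the chord is tangent to the convex curve `K t ^ p`: at `t₀` the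
values agree (`e1`, `e3`) and so do the slopes (`e2`). A tangent stays below the curve. -/
theorem chord_le_kantorovichConst_mul_rpow {p : ℝ} (hp : p < 0 ∨ 1 < p) {h t : ℝ} (hh : 1 < h)
    (ht : 0 < t) :
    (h ^ p - 1) / (h - 1) * t + (h - h ^ p) / (h - 1) ≤ kantorovichConst h p * t ^ p := by
  obtain ⟨h1, h2⟩ := kantorovich_aux_pos hp hh
  have hK := kantorovichConst_pos hp hh
  have h3 : ¬ (p = 0 ∨ p = 1 ∨ h = 1) := by
    rintro (rfl | rfl | rfl) <;> simp_all
  have hp0 : p ≠ 0 := fun e => h3 (Or.inl e)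
  have hp1 : p - 1 ≠ 0 := fun e => h3 (Or.inr (Or.inl (by linarith)))
  have hh1 : h - 1 ≠ 0 := by linarith
  have hq : h ^ p - h ≠ 0 := fun e => by simp [e] at h1
  have hq1 : h ^ p - 1 ≠ 0 := fun e => by simp [e] at h2
  -- the point of tangency
  set t₀ := (h ^ p - h) / (p - 1) / ((h ^ p - 1) / p) with ht₀
  have ht₀pos : 0 < t₀ := div_pos h1 h2
  have e1 : kantorovichConst h p * t₀ ^ p = (h ^ p - h) / ((p - 1) * (h - 1)) := by
    rw [kantorovichConst, if_neg h3]
    have : (p - 1) / p * ((h ^ p - 1) / (h ^ p - h)) = t₀⁻¹ := by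
      rw [ht₀]; field_simp
    rw [this, Real.inv_rpow ht₀pos.le, mul_assoc,
      inv_mul_cancel₀ (Real.rpow_pos_of_pos ht₀pos p).ne', mul_one]
  have e2 : kantorovichConst h p * (p * (t₀ ^ p / t₀)) = (h ^ p - 1) / (h - 1) := by
    calc kantorovichConst h p * (p * (t₀ ^ p / t₀))
        = p * (kantorovichConst h p * t₀ ^ p) / t₀ := by ring
      _ = (h ^ p - 1) / (h - 1) := by rw [e1, ht₀]; field_simp
  have e3 : (h ^ p - 1) / (h - 1) * t₀ + (h - h ^ p) / (h - 1)
      = (h ^ p - h) / ((p - 1) * (h - 1)) := by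
    rw [ht₀]; field_simp; ring
  have := mul_le_mul_of_nonneg_left (rpow_tangent_le hp ht₀pos ht) hK.le
  rw [mul_add, e1, ← mul_assoc, e2] at this
  linarith

/-- The chord of `t ↦ t ^ p` over `[m, M]` lies above the graph there, and below the graph of
`t ↦ K(M / m, p) t ^ p` on the whole positive half line. -/
theorem exists_chord_rpow {p : ℝ} (hp : p < 0 ∨ 1 < p) {m M : ℝ} (hm : 0 < m) (hmM : m < M) :
    ∃ a b : ℝ, (1 < p → 0 ≤ a) ∧ (∀ t, m ≤ t → t ≤ M → t ^ p ≤ a * t + b) ∧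
      ∀ t, 0 < t → a * t + b ≤ kantorovichConst (M / m) p * t ^ p := by
  have hh : 1 < M / m := (one_lt_div hm).mpr hmM
  have hmp := Real.rpow_pos_of_pos hm p
  -- The substitution `t = m s` reduces `[m, M]` to `[1, M / m]` and multiplies powers by `m ^ p`.
  set α := ((M / m) ^ p - 1) / (M / m - 1)
  set β := (M / m - (M / m) ^ p) / (M / m - 1)
  have hs : ∀ t, 0 < t → t ^ p = m ^ p * (t / m) ^ p := fun t ht => by
    rw [Real.div_rpow ht.le hm.le, mul_div_cancel₀ _ hmp.ne']
  have hl : ∀ t, m ^ p * α / m * t + m ^ p * β = m ^ p * (α * (t / m) + β) := fun t => by ring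
  refine ⟨m ^ p * α / m, m ^ p * β, fun hp1 => ?_, fun t h1 h2 => ?_, fun t ht => ?_⟩
  · have : 1 ≤ (M / m) ^ p := Real.one_le_rpow hh.le (by linarith)
    exact div_nonneg (mul_nonneg hmp.le (div_nonneg (by linarith) (by linarith))) hm.le
  · rw [hs t (hm.trans_le h1), hl]
    refine mul_le_mul_of_nonneg_left ?_ hmp.le
    exact rpow_le_chord hp hh ((one_le_div hm).mpr h1) (by gcongr)
  · rw [hs t ht, hl, mul_left_comm]
    exact mul_le_mul_of_nonneg_left
      (chord_le_kantorovichConst_mul_rpow hp hh (div_pos ht hm)) hmp.le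

/-! ### Operator inequalities by functional calculus in a C⋆-algebra. -/

section CStar

theorem cfc_affine {R : Type*} [CStarAlgebra R] {x : R} (hx : IsSelfAdjoint x) (a b : ℝ) :
    cfc (fun t : ℝ => a * t + b) x = a • x + algebraMap ℝ R b := by
  rw [cfc_add .., cfc_const_mul .., cfc_id' .., cfc_const ..]

variable {R : Type*} [CStarAlgebra R] [PartialOrder R] [StarOrderedRing R]

theorem IsStrictlyPositive.of_algebraMap_le {m : ℝ} (hm : 0 < m) {x : R}
    (h : algebraMap ℝ R m ≤ x) : IsStrictlyPositive x :=
  (isStrictlyPositive_algebraMap hm).of_le h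

theorem IsStrictlyPositive.continuousOn_rpow {x : R} (hx : IsStrictlyPositive x) (p : ℝ) :
    ContinuousOn (fun t : ℝ => t ^ p) (spectrum ℝ x) :=
  fun t ht => (Real.continuousAt_rpow_const t p (Or.inl (hx.spectrum_pos ht).ne')).continuousWithinAt

theorem CFC.rpow_le_affine {p m M a b : ℝ} (hm : 0 < m) {x : R} (hmx : algebraMap ℝ R m ≤ x)
    (hxM : x ≤ algebraMap ℝ R M) (h : ∀ t, m ≤ t → t ≤ M → t ^ p ≤ a * t + b) :
    x ^ p ≤ a • x + algebraMap ℝ R b := by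
  have hx := IsStrictlyPositive.of_algebraMap_le hm hmx
  rw [CFC.rpow_eq_cfc_real hx.nonneg, ← cfc_affine hx.isSelfAdjoint]
  exact cfc_mono (fun t ht => h t
    ((algebraMap_le_iff_le_spectrum hx.isSelfAdjoint).mp hmx t ht)
    ((le_algebraMap_iff_spectrum_le hx.isSelfAdjoint).mp hxM t ht)) (hx.continuousOn_rpow p)

/-- The scalar bound is required on the whole half line because the lemma is later applied to an
operator whose spectrum may exceed `M`. -/
theorem CFC.affine_le_smul_rpow {p a b K : ℝ} {x : R} (hx : IsStrictlyPositive x)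
    (h : ∀ t, 0 < t → a * t + b ≤ K * t ^ p) :
    a • x + algebraMap ℝ R b ≤ K • x ^ p := by
  have hc := hx.continuousOn_rpow p
  rw [CFC.rpow_eq_cfc_real hx.nonneg, ← cfc_affine hx.isSelfAdjoint, ← cfc_const_mul K _ x hc]
  exact cfc_mono (fun t ht => h t (hx.spectrum_pos ht)) (by fun_prop) (hc.const_mul K)

theorem algebraMap_le_sum_smul {ι : Type*} [Fintype ι] {ω : ι → ℝ} (hω : ∀ j, 0 ≤ ω j)
    (hs : ∑ j, ω j = 1) {m : ℝ} {x : ι → R} (h : ∀ j, algebraMap ℝ R m ≤ x j) :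
    algebraMap ℝ R m ≤ ∑ j, ω j • x j := by
  calc algebraMap ℝ R m = ∑ j, ω j • algebraMap ℝ R m := by
        rw [← Finset.sum_smul, hs, one_smul]
    _ ≤ _ := Finset.sum_le_sum fun j _ => smul_le_smul_of_nonneg_left (h j) (hω j)

theorem sum_smul_le_algebraMap {ι : Type*} [Fintype ι] {ω : ι → ℝ} (hω : ∀ j, 0 ≤ ω j)
    (hs : ∑ j, ω j = 1) {M : ℝ} {x : ι → R} (h : ∀ j, x j ≤ algebraMap ℝ R M) :
    ∑ j, ω j • x j ≤ algebraMap ℝ R M := by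
  calc _ ≤ ∑ j, ω j • algebraMap ℝ R M :=
        Finset.sum_le_sum fun j _ => smul_le_smul_of_nonneg_left (h j) (hω j)
    _ = _ := by rw [← Finset.sum_smul, hs, one_smul]

/-- Converse of Jensen's inequality for negative powers. -/
theorem CFC.sum_smul_rpow_le {ι : Type*} [Fintype ι] {ω : ι → ℝ} (hω : ∀ j, 0 ≤ ω j)
    (hs : ∑ j, ω j = 1) {p m M : ℝ} (hp : p < 0) (hm : 0 < m) (hmM : m < M) {x : ι → R}
    (hmx : ∀ j, algebraMap ℝ R m ≤ x j) (hxM : ∀ j, x j ≤ algebraMap ℝ R M) :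
    ∑ j, ω j • x j ^ p ≤ kantorovichConst (M / m) p • (∑ j, ω j • x j) ^ p := by
  obtain ⟨a, b, -, h1, h2⟩ := exists_chord_rpow (Or.inl hp) hm hmM
  calc ∑ j, ω j • x j ^ p ≤ ∑ j, ω j • (a • x j + algebraMap ℝ R b) :=
        Finset.sum_le_sum fun j _ =>
          smul_le_smul_of_nonneg_left (CFC.rpow_le_affine hm (hmx j) (hxM j) h1) (hω j)
    -- An affine function commutes with averaging, since the weights sum to `1`.
    _ = a • (∑ j, ω j • x j) + algebraMap ℝ R b := by
        simp only [smul_add, Finset.sum_add_distrib, ← Finset.sum_smul, hs, one_smul,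
          Finset.smul_sum, smul_comm a]
    _ ≤ _ := CFC.affine_le_smul_rpow
        (.of_algebraMap_le hm (algebraMap_le_sum_smul hω hs hmx)) h2

/-- Powers with exponent at least `1` preserve the order up to the Kantorovich constant. -/
theorem CFC.rpow_le_smul_rpow {p m M : ℝ} (hp : 1 ≤ p) (hm : 0 < m) (hmM : m < M) {x y : R}
    (hmx : algebraMap ℝ R m ≤ x) (hxM : x ≤ algebraMap ℝ R M) (hxy : x ≤ y) :
    x ^ p ≤ kantorovichConst (M / m) p • y ^ p := by
  -- The chord argument excludes `p = 1`, where the constant is `1` by convention.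
  rcases hp.eq_or_lt with rfl | hp
  · have hx := IsStrictlyPositive.of_algebraMap_le hm hmx
    simpa [kantorovichConst, CFC.rpow_one x hx.nonneg, CFC.rpow_one y (hx.nonneg.trans hxy)]
      using hxy
  · obtain ⟨a, b, ha, h1, h2⟩ := exists_chord_rpow (Or.inr hp) hm hmM
    calc x ^ p ≤ a • x + algebraMap ℝ R b := CFC.rpow_le_affine hm hmx hxM h1
      -- The chord has slope `a ≥ 0`, so it preserves the operator order.
      _ ≤ a • y + algebraMap ℝ R b := by
          gcongr
          exact ha hp
      _ ≤ _ := CFC.affine_le_smul_rpow (.of_algebraMap_le hm (hmx.trans hxy)) h2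

theorem ringInverse_algebraMap {c : ℝ} (hc : 0 < c) :
    Ring.inverse (algebraMap ℝ R c) = algebraMap ℝ R c⁻¹ := by
  have h := (Ring.eq_mul_inverse_iff_mul_eq (algebraMap ℝ R c⁻¹) 1 _
    (isStrictlyPositive_algebraMap hc).isUnit).mpr
    (by rw [← map_mul, inv_mul_cancel₀ hc.ne', map_one])
  rw [h, one_mul]

theorem ringInverse_smul {c : ℝ} (hc : 0 < c) {x : R} (hx : IsStrictlyPositive x) :
    Ring.inverse (c • x) = c⁻¹ • Ring.inverse x := by
  have h := (Ring.eq_mul_inverse_iff_mul_eq (c⁻¹ • Ring.inverse x) 1 _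
    (hx.smul hc).isUnit).mpr
    (by rw [smul_mul_smul_comm, inv_mul_cancel₀ hc.ne', Ring.inverse_mul_cancel _ hx.isUnit,
      one_smul])
  rw [h, one_mul]

theorem ringInverse_le_algebraMap {m : ℝ} (hm : 0 < m) {x : R} (h : algebraMap ℝ R m ≤ x) :
    Ring.inverse x ≤ algebraMap ℝ R m⁻¹ :=
  ringInverse_algebraMap (R := R) hm ▸
    CStarAlgebra.ringInverse_le_ringInverse h (isStrictlyPositive_algebraMap hm)

theorem algebraMap_le_ringInverse {M : ℝ} (hM : 0 < M) {x : R} (hx : IsStrictlyPositive x)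
    (h : x ≤ algebraMap ℝ R M) : algebraMap ℝ R M⁻¹ ≤ Ring.inverse x :=
  ringInverse_algebraMap (R := R) hM ▸ CStarAlgebra.ringInverse_le_ringInverse h hx

theorem CFC.ringInverse_rpow {x : R} (hx : IsStrictlyPositive x) (r : ℝ) :
    Ring.inverse x ^ r = x ^ (-r) := by
  rw [CFC.inverse_eq_rpow_neg_one hx, CFC.rpow_rpow x _ _ (by norm_num) hx, neg_one_mul]

/-- Comparison with `1` is a condition on the spectrum alone, so exponents above `1` are allowed. -/
theorem CFC.rpow_le_one_of_le_one {r : ℝ} (hr : 0 ≤ r) {x : R} (hx : IsStrictlyPositive x)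
    (h : x ≤ 1) : x ^ r ≤ 1 := by
  rw [CFC.rpow_eq_cfc_real hx.nonneg]
  refine cfc_le_one _ _ fun t ht => Real.rpow_le_one (hx.spectrum_pos ht).le ?_ hr
  exact (le_algebraMap_iff_spectrum_le hx.isSelfAdjoint).mp (by simpa using h) t ht

end CStar

/-! ### Arithmetic and harmonic means of powers. -/

section Means

variable {H : Type*} [NormedAddCommGroup H] [InnerProductSpace ℂ H] [CompleteSpace H]

/-- Provides the spectral bounds needed to apply `CFC.rpow_le_smul_rpow` to the harmonic mean. -/
theorem harmonicMean_mem_Icc {n : ℕ} {ω : Fin n → ℝ} (hω : ∀ j, 0 ≤ ω j) (hs : ∑ j, ω j = 1)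
    {m M : ℝ} (hm : 0 < m) (hM : 0 < M) {A : Fin n → PosInvOp H}
    (hmA : ∀ j, algebraMap ℝ (H →L[ℂ] H) m ≤ (A j).1)
    (hAM : ∀ j, (A j).1 ≤ algebraMap ℝ (H →L[ℂ] H) M) :
    algebraMap ℝ (H →L[ℂ] H) m ≤ harmonicMean ω A ∧
      harmonicMean ω A ≤ algebraMap ℝ (H →L[ℂ] H) M := by
  have h1 := algebraMap_le_sum_smul hω hs fun j => algebraMap_le_ringInverse hM (A j).2 (hAM j)
  have h2 := sum_smul_le_algebraMap hω hs fun j => ringInverse_le_algebraMap hm (hmA j)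
  have hM' := inv_pos.mpr hM
  have h3 := algebraMap_le_ringInverse (inv_pos.mpr hm) (.of_algebraMap_le hM' h1) h2
  have h4 := ringInverse_le_algebraMap hM' h1
  rw [inv_inv] at h3 h4
  exact ⟨h3, h4⟩

theorem isStrictlyPositive_sum_ringInverse {n : ℕ} {ω : Fin n → ℝ} (hω : ∀ j, 0 ≤ ω j)
    (hs : ∑ j, ω j = 1) {M : ℝ} (hM : 0 < M) {A : Fin n → PosInvOp H}
    (hAM : ∀ j, (A j).1 ≤ algebraMap ℝ (H →L[ℂ] H) M) :
    IsStrictlyPositive (∑ j, ω j • Ring.inverse (A j).1) :=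
  .of_algebraMap_le (inv_pos.mpr hM)
    (algebraMap_le_sum_smul hω hs fun j => algebraMap_le_ringInverse hM (A j).2 (hAM j))

/-- Converse Jensen with exponent `-r` for the inverses of the `A j`. They lie in `[M⁻¹, m⁻¹]`,
whose endpoints have the same ratio `M / m`. -/
theorem arithmeticMean_rpow_le {n : ℕ} {ω : Fin n → ℝ} (hω : ∀ j, 0 ≤ ω j) (hs : ∑ j, ω j = 1)
    {m M r : ℝ} (hm : 0 < m) (hmM : m < M) (hr : 0 < r) {A : Fin n → PosInvOp H}
    (hmA : ∀ j, algebraMap ℝ (H →L[ℂ] H) m ≤ (A j).1)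
    (hAM : ∀ j, (A j).1 ≤ algebraMap ℝ (H →L[ℂ] H) M) :
    arithmeticMean ω (fun j => (A j).rpow r) ≤
      kantorovichConst (M / m) (-r) • harmonicMean ω A ^ r := by
  have hM := hm.trans hmM
  have h := CFC.sum_smul_rpow_le hω hs (neg_lt_zero.mpr hr) (inv_pos.mpr hM)
    ((inv_lt_inv₀ hM hm).mpr hmM) (fun j => algebraMap_le_ringInverse hM (A j).2 (hAM j))
    (fun j => ringInverse_le_algebraMap hm (hmA j))
  have hS := isStrictlyPositive_sum_ringInverse hω hs hM hAM
  simp only [inv_div_inv, CFC.ringInverse_rpow (A _).2, neg_neg,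
    ← CFC.ringInverse_rpow hS] at h
  exact h

/-- Converse Jensen with exponent `-r` for the `A j` themselves, followed by inversion, which
reverses the order. -/
theorem smul_arithmeticMean_rpow_le {n : ℕ} {ω : Fin n → ℝ} (hω : ∀ j, 0 ≤ ω j)
    (hs : ∑ j, ω j = 1) {m M r : ℝ} (hm : 0 < m) (hmM : m < M) (hr : 0 < r)
    {A : Fin n → PosInvOp H} (hmA : ∀ j, algebraMap ℝ (H →L[ℂ] H) m ≤ (A j).1)
    (hAM : ∀ j, (A j).1 ≤ algebraMap ℝ (H →L[ℂ] H) M) :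
    (kantorovichConst (M / m) (-r))⁻¹ • arithmeticMean ω A ^ r ≤
      harmonicMean ω (fun j => (A j).rpow r) := by
  have hM := hm.trans hmM
  have h := CFC.sum_smul_rpow_le hω hs (neg_lt_zero.mpr hr) hm hmM hmA hAM
  have hP : IsStrictlyPositive (arithmeticMean ω A) :=
    .of_algebraMap_le hm (algebraMap_le_sum_smul hω hs hmA)
  have hT : IsStrictlyPositive (∑ j, ω j • (A j).1 ^ (-r)) := by
    simp only [← CFC.inverse_rpow (A _).1 r hr.ne' (A _).2]
    refine isStrictlyPositive_sum_ringInverse hω hs (A := fun j => (A j).rpow r)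
      (Real.rpow_pos_of_pos hM r) fun j => ?_
    -- The constant function `M ^ r` is used as affine majorant, giving `A j ^ r ≤ M ^ r`.
    have := CFC.rpow_le_affine (p := r) (a := 0) (b := M ^ r) hm (hmA j) (hAM j) fun t h1 h2 => by
      rw [zero_mul, zero_add]
      exact Real.rpow_le_rpow (hm.le.trans h1) h2 hr.le
    rwa [zero_smul, zero_add] at this
  have hK := kantorovichConst_pos (Or.inl (neg_lt_zero.mpr hr)) ((one_lt_div hm).mpr hmM)
  have h2 := CStarAlgebra.ringInverse_le_ringInverse h hT
  change Ring.inverse (_ • arithmeticMean ω A ^ (-r)) ≤ _ at h2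
  rw [ringInverse_smul hK (hP.rpow _ _), CFC.inverse_rpow _ _ (neg_ne_zero.mpr hr.ne') hP,
    neg_neg] at h2
  simp only [← CFC.inverse_rpow (A _).1 r hr.ne' (A _).2] at h2
  exact h2

end Means

/-! ### The sandwich argument for the deformed mean. -/

theorem corollary3p7 {H : Type*} [NormedAddCommGroup H] [InnerProductSpace ℂ H] [CompleteSpace H]
    {n : ℕ} (𝔐 : MultiOperatorMean H n) (σ : OperatorMean H) (hσ : ¬ σ.IsLeftTrivial)
    (ω : Fin n → ℝ) (hω_nonneg : ∀ j, 0 ≤ ω j) (hω_sum : ∑ j, ω j = 1)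
    (hHA : ∀ B : Fin n → PosInvOp H,
      harmonicMean ω B ≤ (deformedMean 𝔐 σ B).1 ∧ (deformedMean 𝔐 σ B).1 ≤ arithmeticMean ω B)
    (m M : ℝ) (hm : 0 < m) (hmM : m < M) (A : Fin n → PosInvOp H)
    (hA : ∀ j, m • (1 : H →L[ℂ] H) ≤ (A j).1 ∧ (A j).1 ≤ M • (1 : H →L[ℂ] H)) :
    (∀ r : ℝ, 0 < r → r < 1 →
      (kantorovichConst (M / m) (-r))⁻¹ • (deformedMean 𝔐 σ A).1 ^ r
          ≤ (deformedMean 𝔐 σ (fun j => (A j).rpow r)).1 ∧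
        (deformedMean 𝔐 σ (fun j => (A j).rpow r)).1
          ≤ kantorovichConst (M / m) (-r) • (deformedMean 𝔐 σ A).1 ^ r) ∧
    (∀ r : ℝ, 1 ≤ r →
      ((kantorovichConst (M / m) (-r))⁻¹ * (kantorovichConst (M / m) r)⁻¹) •
            (deformedMean 𝔐 σ A).1 ^ r
          ≤ (deformedMean 𝔐 σ (fun j => (A j).rpow r)).1 ∧
        (deformedMean 𝔐 σ (fun j => (A j).rpow r)).1
          ≤ (kantorovichConst (M / m) (-r) * kantorovichConst (M / m) r) •
            (deformedMean 𝔐 σ A).1 ^ r) ∧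
    ((deformedMean 𝔐 σ A).1 ≤ 1 →
      (∀ r : ℝ, 0 < r → r < 1 →
        (deformedMean 𝔐 σ (fun j => (A j).rpow r)).1
          ≤ kantorovichConst (M / m) (-r) • (1 : H →L[ℂ] H)) ∧
      (∀ r : ℝ, 1 ≤ r →
        (deformedMean 𝔐 σ (fun j => (A j).rpow r)).1
          ≤ (kantorovichConst (M / m) (-r) * kantorovichConst (M / m) r) •
            (1 : H →L[ℂ] H))) := by
  have hM := hm.trans hmM
  have hh : 1 < M / m := (one_lt_div hm).mpr hmM
  simp only [← Algebra.algebraMap_eq_smul_one] at hA ⊢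
  have hmA := fun j => (hA j).1
  have hAM := fun j => (hA j).2
  set D := (deformedMean 𝔐 σ A).1
  obtain ⟨hHD, hDA⟩ : harmonicMean ω A ≤ D ∧ D ≤ arithmeticMean ω A := hHA A
  obtain ⟨hmH, hHM⟩ := harmonicMean_mem_Icc hω_nonneg hω_sum hm hM hmA hAM
  have hDM : D ≤ algebraMap ℝ _ M :=
    hDA.trans (sum_smul_le_algebraMap hω_nonneg hω_sum hAM)
  have hK : ∀ r : ℝ, 0 < r → 0 < kantorovichConst (M / m) (-r) := fun r hr =>
    kantorovichConst_pos (Or.inl (neg_lt_zero.mpr hr)) hh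
  -- The factor `c` is the cost of comparing `r`-th powers: `1` for `r < 1` and `K(h, r)` for `r ≥
  -- 1`, here and in `lower`.
  have upper : ∀ r c : ℝ, 0 < r → harmonicMean ω A ^ r ≤ c • D ^ r →
      (deformedMean 𝔐 σ (fun j => (A j).rpow r)).1 ≤
        (kantorovichConst (M / m) (-r) * c) • D ^ r := fun r c hr h => by
    rw [mul_smul]
    exact ((hHA _).2.trans (arithmeticMean_rpow_le hω_nonneg hω_sum hm hmM hr hmA hAM)).trans
      (smul_le_smul_of_nonneg_left h (hK r hr).le)
  have lower : ∀ r c : ℝ, 0 < r → 0 < c → D ^ r ≤ c • arithmeticMean ω A ^ r →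
      ((kantorovichConst (M / m) (-r))⁻¹ * c⁻¹) • D ^ r ≤
        (deformedMean 𝔐 σ (fun j => (A j).rpow r)).1 := fun r c hr hc h => by
    have h' := smul_le_smul_of_nonneg_left h (inv_pos.mpr hc).le
    rw [inv_smul_smul₀ hc.ne'] at h'
    rw [mul_smul]
    refine le_trans ?_ ((smul_arithmeticMean_rpow_le hω_nonneg hω_sum hm hmM hr hmA hAM).trans
      (hHA _).1)
    exact smul_le_smul_of_nonneg_left h' (inv_nonneg.mpr (hK r hr).le)
  have upper_lt : ∀ r : ℝ, 0 < r → r < 1 → (deformedMean 𝔐 σ (fun j => (A j).rpow r)).1 ≤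
      kantorovichConst (M / m) (-r) • D ^ r := fun r h0 h1 => by
    simpa using upper r 1 h0 (by simpa using CFC.rpow_le_rpow ⟨h0.le, h1.le⟩ hHD)
  have upper_ge : ∀ r : ℝ, 1 ≤ r → (deformedMean 𝔐 σ (fun j => (A j).rpow r)).1 ≤
      (kantorovichConst (M / m) (-r) * kantorovichConst (M / m) r) • D ^ r := fun r h1 =>
    upper r _ (by linarith) (CFC.rpow_le_smul_rpow h1 hm hmM hmH hHM hHD)
  have hK' : ∀ r : ℝ, 1 ≤ r → 0 < kantorovichConst (M / m) r := fun r h1 => by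
    rcases h1.eq_or_lt with rfl | h1
    · simp [kantorovichConst]
    · exact kantorovichConst_pos (Or.inr h1) hh
  refine ⟨fun r h0 h1 => ⟨?_, upper_lt r h0 h1⟩, fun r h1 => ⟨?_, upper_ge r h1⟩, fun hD =>
    ⟨fun r h0 h1 => ?_, fun r h1 => ?_⟩⟩
  · simpa using lower r 1 h0 one_pos (by simpa using CFC.rpow_le_rpow ⟨h0.le, h1.le⟩ hDA)
  -- Here `D` is the smaller operator, and it lies in `[m, M]` because the two means do.
  · exact lower r _ (by linarith) (hK' r h1)
      (CFC.rpow_le_smul_rpow h1 hm hmM (hmH.trans hHD) hDM hDA)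
  · rw [Algebra.algebraMap_eq_smul_one]
    exact (upper_lt r h0 h1).trans (smul_le_smul_of_nonneg_left
      (CFC.rpow_le_one_of_le_one h0.le (deformedMean 𝔐 σ A).2 hD) (hK r h0).le)
  · rw [Algebra.algebraMap_eq_smul_one]
    have h0 : 0 < r := by linarith
    exact (upper_ge r h1).trans (smul_le_smul_of_nonneg_left
      (CFC.rpow_le_one_of_le_one h0.le (deformedMean 𝔐 σ A).2 hD)
      (mul_nonneg (hK r h0).le (hK' r h1).le))
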